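/- **Theorem (real $t$-Jordan canonical form).** Let $n,p\ge 1$. A tensor $\mathcal A\in\mathbb R^{n\times n\times p}$ is given by its frontal slices $A^{(1)},\dots,A^{(p)}\in\mathbb R^{n\times n}$. The $t$-product of $\mathcal A,\mathcal B\in\mathbb R^{n\times n\times p}$ is $$\mathcal A*\mathcal B=\mathrm{fold}\big(\mathrm{bcirc}(\mathcal A)\,\mathrm{unfold}(\mathcal B)\big),$$ where $\mathrm{unfold}(\mathcal B)$ is the $np\times n$ matrix obtained by stacking $B^{(1)},\dots,B^{(p)}$ vertically, $\mathrm{fold}$ is the inverse of $\mathrm{unfold}$, and $\mathrm{bcirc}(\mathcal A)$ is the block-circulant $np\times np$ matrix whose $(k,l)$ block is $A^{(r)}$, with $r\in\{1,\dots,p\}$ and $r\equiv k-l+1 \pmod p$. The identity tensor $\mathcal I$ has $I^{(1)}=I_n$ and $I^{(k)}=0$ for $k\ge2$. A tensor $\mathcal P\in\mathbb R^{n\times n\times p}$ is $t$-invertible if there is a (necessarily unique) tensor $\mathcal P^{-1}\in\mathbb R^{n\times n\times p}$ with $\mathcal P*\mathcal P^{-1}=\mathcal P^{-1}*\mathcal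 P=\mathcal I$. A matrix $J\in\mathbb R^{n\times n}$ is upper block-bi-diagonal if there is a partition $n=n_1+\dots+n_r$ into consecutive blocks with $n_j\in\{1,2\}$ such that, in the corresponding block decomposition of $J$, only the diagonal blocks $J_{ii}$ (of size $n_i\times n_i$) and the first superdiagonal blocks $J_{i,i+1}$ (of size $n_i\times n_{i+1}$) may be nonzero. A tensor is $f$-upper-block-bi-diagonal if each of its frontal slices is upper block-bi-diagonal. Then for every $\mathcal A\in\mathbb R^{n\times n\times p}$ there exist a $t$-invertible tensor $\mathcal P\in\mathbb R^{n\times n\times p}$ and an $f$-upper-block-bi-diagonal tensor $\mathcal J\in\mathbb R^{n\times n\times p}$ such that $$\mathcal A=\mathcal P*\mathcal J*\mathcal P^{-1}.$$ Moreover, each frontal slice of $\mathcal J$ is upper block-bi-diagonal, with diagonal and first superdiagonal blocks of size at most $2\times2$. -/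

import Mathlib

namespace TProduct

/-- Third-order tensors of size `m × n × p`, given by their frontal slices: the entry `(i, j, k)` of
`A` is `A k i j`. Slices are indexed from `0`, so `A 0` is the first frontal slice. -/
abbrev Tensor (F : Type*) (m n p : ℕ) : Type _ := Fin p → Matrix (Fin m) (Fin n) F

/-- The frontal slices of a tensor, stacked on top of each other. -/
def unfold {F : Type*} {m n p : ℕ} (A : Tensor F m n p) : Matrix (Fin p × Fin m) (Fin n) F :=
  Matrix.of fun r j => A r.1 r.2 j

/-- The inverse of `unfold`. -/
def fold {F : Type*} {m n p : ℕ} (M : Matrix (Fin p × Fin m) (Fin n) F) : Tensor F m n p :=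
  fun k => Matrix.of fun i j => M (k, i) j

/-- The block-circulant matrix of a tensor; its block in block row `k` and block column `l` is
the slice with index `k - l` modulo `p`. -/
def bcirc {F : Type*} {m n p : ℕ} (A : Tensor F m n p) :
    Matrix (Fin p × Fin m) (Fin p × Fin n) F :=
  Matrix.of fun r s => A (r.1 - s.1) r.2 s.2

/-- The t-product `A * B = fold (bcirc A · unfold B)`. -/
def tProd {F : Type*} [CommRing F] {m n l p : ℕ} (A : Tensor F m n p) (B : Tensor F n l p) :
    Tensor F m l p :=
  fold (bcirc A * unfold B)

/-- The identity tensor: the first frontal slice is the identity matrix, the others vanish. -/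
def tOne (F : Type*) [CommRing F] (n p : ℕ) [NeZero p] : Tensor F n n p :=
  fun k => if k = 0 then 1 else 0

/-- `X` is the t-inverse of `A`. -/
def IsTInverse {F : Type*} [CommRing F] {n p : ℕ} [NeZero p] (A X : Tensor F n n p) : Prop :=
  tProd A X = tOne F n p ∧ tProd X A = tOne F n p

/-- `A` is t-invertible. -/
def IsTInvertible {F : Type*} [CommRing F] {n p : ℕ} [NeZero p] (A : Tensor F n n p) : Prop :=
  ∃ X : Tensor F n n p, IsTInverse A X

/-- With respect to the partition `c` of `n` into consecutive blocks, only the diagonal blocks and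
the first superdiagonal blocks of `J` may be nonzero. (`c.index i` is the block containing `i`.) -/
def IsBlockBiDiagonalFor {F : Type*} [Zero F] {n : ℕ} (c : Composition n)
    (J : Matrix (Fin n) (Fin n) F) : Prop :=
  ∀ i j : Fin n, J i j ≠ 0 →
    (c.index j : ℕ) = (c.index i : ℕ) ∨ (c.index j : ℕ) = (c.index i : ℕ) + 1

/-- Upper block-bi-diagonal matrices: for some partition of `n` into parts equal to `1` or `2`, only
the diagonal and first superdiagonal blocks may be nonzero. -/
def IsUpperBlockBiDiagonal {F : Type*} [Zero F] {n : ℕ} (J : Matrix (Fin n) (Fin n) F) : Prop :=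
  ∃ c : Composition n, (∀ b ∈ c.blocks, b = 1 ∨ b = 2) ∧ IsBlockBiDiagonalFor c J

/-- A tensor is f-upper-block-bi-diagonal if each frontal slice is upper block-bi-diagonal. -/
def IsFUpperBlockBiDiagonal {F : Type*} [Zero F] {n p : ℕ} (J : Tensor F n n p) : Prop :=
  ∀ k : Fin p, IsUpperBlockBiDiagonal (J k)

end TProduct

/-! ### Pairing of indices and transport of normal forms between rings -/

namespace TProduct

/-! Tensors under the t-product are matrices over the real group algebra of `ℤ / p`, a finite
product of fields each isomorphic to `ℝ` or `ℂ`. A normal form over these two fields, with one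
vanishing pattern common to all factors, therefore lifts to the group algebra, and a zero entry
there is zero in every frontal slice.

Over a field whose irreducible polynomials have degree at most 2, the structure theorem splits the
`F[X]`-module of a matrix into summands `F[X] ⧸ (q ^ e)`. The basis of `exists_chain_basis` makes
each block bi-diagonal with blocks of size `deg q`. Putting the quadratic summands first aligns all
of them with the partition 2, 2, …, which depends on `n` alone. -/

/-- The partition of `n` into consecutive blocks of size two, followed by a block of size one if
`n` is odd. -/
def pairComposition (n : ℕ) : Composition n where
  blocks := List.replicate (n / 2) 2 ++ List.replicate (n % 2) 1
  blocks_pos := by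
    intro i hi
    simp only [List.mem_append, List.mem_replicate] at hi
    omega
  blocks_sum := by
    simp only [List.sum_append, List.sum_replicate, smul_eq_mul]
    omega

theorem pairComposition_blocks {n b : ℕ} (hb : b ∈ (pairComposition n).blocks) :
    b = 1 ∨ b = 2 := by
  simp only [pairComposition, List.mem_append, List.mem_replicate] at hb
  omega

theorem pairComposition_index {n : ℕ} (j : Fin n) :
    ((pairComposition n).index j : ℕ) = j / 2 := by
  have hlen : (pairComposition n).length = n / 2 + n % 2 := by
    simp [Composition.length, pairComposition]
  have hi := ((pairComposition n).index j).2
  have h1 := (pairComposition n).sizeUpTo_index_le j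
  have h2 := (pairComposition n).lt_sizeUpTo_index_succ j
  have key : ∀ i, (pairComposition n).sizeUpTo i
      = min i (n / 2) * 2 + min (i - n / 2) (n % 2) := by
    intro i
    simp [Composition.sizeUpTo, pairComposition, List.take_append, List.take_replicate]
  rw [key] at h1 h2
  rw [Fin.val_succ] at h2
  omega

/-- Only the diagonal and first superdiagonal `2 × 2` blocks of `M` may be nonzero. -/
def IsPairBiDiagonal {R : Type*} [Zero R] {n : ℕ} (M : Matrix (Fin n) (Fin n) R) : Prop :=
  ∀ i j : Fin n, M i j ≠ 0 → (j : ℕ) / 2 = i / 2 ∨ (j : ℕ) / 2 = i / 2 + 1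

theorem IsPairBiDiagonal.isBlockBiDiagonalFor {R : Type*} [Zero R] {n : ℕ}
    {M : Matrix (Fin n) (Fin n) R} (hM : IsPairBiDiagonal M) :
    IsBlockBiDiagonalFor (pairComposition n) M := by
  intro i j hij
  simpa only [pairComposition_index] using hM i j hij

/-- Every square matrix over `R` is similar to one satisfying `IsPairBiDiagonal`. -/
def HasPairForms (R : Type*) [CommRing R] : Prop :=
  ∀ (n : ℕ) (A : Matrix (Fin n) (Fin n) R), ∃ P Q M : Matrix (Fin n) (Fin n) R,
    P * Q = 1 ∧ Q * P = 1 ∧ IsPairBiDiagonal M ∧ A = P * M * Q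

theorem HasPairForms.of_ringEquiv {R S : Type*} [CommRing R] [CommRing S] (f : R ≃+* S)
    (h : HasPairForms R) : HasPairForms S := by
  intro n A
  obtain ⟨P, Q, M, h1, h2, h3, h4⟩ := h n (f.symm.mapMatrix A)
  refine ⟨f.mapMatrix P, f.mapMatrix Q, f.mapMatrix M, ?_, ?_, ?_, ?_⟩
  · rw [← map_mul, h1, map_one]
  · rw [← map_mul, h2, map_one]
  · intro i j hij
    apply h3 i j
    intro h0
    simp [h0] at hij
  · rw [← map_mul, ← map_mul, ← h4]
    ext i j
    simp

/-- The forms in the factors glue because the allowed positions are the same in each: an entry of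
the product is nonzero only if some component is. -/
theorem HasPairForms.pi {ι : Type*} {R : ι → Type*} [∀ i, CommRing (R i)]
    (h : ∀ i, HasPairForms (R i)) : HasPairForms (∀ i, R i) := by
  intro n A
  choose P Q M h1 h2 h3 h4 using fun t => h t n (A.map fun x => x t)
  refine ⟨.of fun i j t => P t i j, .of fun i j t => Q t i j, .of fun i j t => M t i j, ?_, ?_, ?_, ?_⟩
  · ext i j t
    have := congrFun₂ (h1 t) i j
    rw [Matrix.mul_apply] at this ⊢
    rw [Finset.sum_apply]
    refine this.trans ?_
    rw [Matrix.one_apply, Matrix.one_apply]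
    split_ifs <;> rfl
  · ext i j t
    have := congrFun₂ (h2 t) i j
    rw [Matrix.mul_apply] at this ⊢
    rw [Finset.sum_apply]
    refine this.trans ?_
    rw [Matrix.one_apply, Matrix.one_apply]
    split_ifs <;> rfl
  · intro i j hij
    obtain ⟨t, ht⟩ := Function.ne_iff.1 hij
    exact h3 t i j ht
  · ext i j t
    have := congrFun₂ (h4 t) i j
    simpa only [Matrix.mul_apply, Finset.sum_apply, Pi.mul_apply, Matrix.map_apply,
      Matrix.of_apply] using this

/-! ### Tensors as matrices over the group algebra -/

section GroupAlgebra

variable {p : ℕ}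

/-- A tensor as a matrix over the real group algebra of `ℤ / p`. -/
noncomputable def toGroupAlgebra {n : ℕ} (A : Tensor ℝ n n p) :
    Matrix (Fin n) (Fin n) (AddMonoidAlgebra ℝ (Fin p)) :=
  Matrix.of fun i j => .ofCoeff (Finsupp.equivFunOnFinite.symm fun k => A k i j)

/-- The tensor whose tubes are the entries of a matrix over the group algebra of `ℤ / p`. -/
noncomputable def ofGroupAlgebra {n : ℕ}
    (M : Matrix (Fin n) (Fin n) (AddMonoidAlgebra ℝ (Fin p))) : Tensor ℝ n n p :=
  fun k => Matrix.of fun i j => (M i j).coeff k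

theorem ofGroupAlgebra_toGroupAlgebra {n : ℕ} (A : Tensor ℝ n n p) :
    ofGroupAlgebra (toGroupAlgebra A) = A := by
  ext k i j
  simp [ofGroupAlgebra, toGroupAlgebra]

variable [NeZero p]

theorem ofGroupAlgebra_one (n : ℕ) :
    ofGroupAlgebra (1 : Matrix (Fin n) (Fin n) (AddMonoidAlgebra ℝ (Fin p))) = tOne ℝ n p := by
  ext k i j
  by_cases hk : k = 0 <;> by_cases hij : i = j <;>
    simp [ofGroupAlgebra, tOne, hk, hij, Matrix.one_apply, AddMonoidAlgebra.one_def]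

/-- Convolution on `ℤ / p` is what a circulant matrix computes. -/
theorem coeff_mul_eq_sum (x y : AddMonoidAlgebra ℝ (Fin p)) (k : Fin p) :
    (x * y).coeff k = ∑ l, x.coeff (k - l) * y.coeff l := by
  classical
  rw [AddMonoidAlgebra.coeff_mul, Finsupp.sum_fintype _ _ (by simp),
    Finset.sum_congr rfl fun i _ => Finsupp.sum_fintype _ _ (by simp), Finset.sum_comm]
  refine Finset.sum_congr rfl fun l _ => ?_
  simp_rw [← eq_sub_iff_add_eq]
  simp

theorem ofGroupAlgebra_mul {n : ℕ}
    (M N : Matrix (Fin n) (Fin n) (AddMonoidAlgebra ℝ (Fin p))) :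
    ofGroupAlgebra (M * N) = tProd (ofGroupAlgebra M) (ofGroupAlgebra N) := by
  ext k i j
  simp [ofGroupAlgebra, tProd, fold, bcirc, unfold, Matrix.mul_apply, Fintype.sum_prod_type,
    coeff_mul_eq_sum]
  rw [Finset.sum_comm]

theorem hasPairForms_groupAlgebra (hR : HasPairForms ℝ) (hC : HasPairForms ℂ) :
    HasPairForms (AddMonoidAlgebra ℝ (Fin p)) := by
  -- An Artinian reduced commutative ring is the product of its residue fields; here each is a
  -- finite extension of `ℝ`.
  refine HasPairForms.of_ringEquiv (IsArtinianRing.equivPi _).toRingEquiv.symm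
    (HasPairForms.pi fun I => ?_)
  let := Ideal.Quotient.field I.asIdeal
  rcases Real.nonempty_algEquiv_or (AddMonoidAlgebra ℝ (Fin p) ⧸ I.asIdeal) with ⟨⟨f⟩⟩ | ⟨⟨f⟩⟩
  · exact hR.of_ringEquiv f.symm.toRingEquiv
  · exact hC.of_ringEquiv f.symm.toRingEquiv

end GroupAlgebra

theorem exists_tJordan (hR : HasPairForms ℝ) (hC : HasPairForms ℂ) (n p : ℕ) [NeZero p]
    (A : Tensor ℝ n n p) :
    ∃ P Pinv J : Tensor ℝ n n p, IsTInverse P Pinv ∧ A = tProd (tProd P J) Pinv ∧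
      ∀ k, IsPairBiDiagonal (J k) := by
  obtain ⟨P, Q, M, h1, h2, h3, h4⟩ := hasPairForms_groupAlgebra (p := p) hR hC n (toGroupAlgebra A)
  refine ⟨ofGroupAlgebra P, ofGroupAlgebra Q, ofGroupAlgebra M, ⟨?_, ?_⟩, ?_, ?_⟩
  · rw [← ofGroupAlgebra_mul, h1, ofGroupAlgebra_one]
  · rw [← ofGroupAlgebra_mul, h2, ofGroupAlgebra_one]
  · rw [← ofGroupAlgebra_mul, ← ofGroupAlgebra_mul, ← h4, ofGroupAlgebra_toGroupAlgebra]
  · intro k i j hij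
    apply h3 i j
    intro h0
    simp [ofGroupAlgebra, h0] at hij

end TProduct

namespace TProduct

open Polynomial Module

/-! ### A block bi-diagonal basis of a cyclic primary module -/

section Chain

variable {F : Type*} [Field F]

/-- The polynomials `p ^ k * X ^ s` with `k < e`, `s < natDegree p`, ordered by decreasing `k` and
then by increasing `s`, modulo `p ^ e`. -/
noncomputable def chainVector (p : F[X]) (e a : ℕ) : F[X] ⧸ Submodule.span F[X] {p ^ e} :=
  Submodule.Quotient.mk (p ^ (e - 1 - a / p.natDegree) * X ^ (a % p.natDegree))

theorem mk_pow_mul_mem_span_chainVector {p : F[X]} {e k : ℕ} (hk : k < e) {r : F[X]}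
    (hr : r.natDegree < p.natDegree) :
    (Submodule.Quotient.mk (p ^ (e - 1 - k) * r) : F[X] ⧸ Submodule.span F[X] {p ^ e}) ∈
      Submodule.span F ((fun b : Fin (e * p.natDegree) => chainVector p e b) ''
        {b | (b : ℕ) / p.natDegree = k}) := by
  have hd : 0 < p.natDegree := by omega
  rw [r.as_sum_range' _ hr, Finset.mul_sum, ← Submodule.mkQ_apply, map_sum]
  refine Submodule.sum_mem _ fun i hi => ?_
  rw [Finset.mem_range] at hi
  have hlt : k * p.natDegree + i < e * p.natDegree := by
    have : (k + 1) * p.natDegree ≤ e * p.natDegree := Nat.mul_le_mul_right _ hk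
    rw [add_mul] at this
    omega
  have hdiv : (k * p.natDegree + i) / p.natDegree = k := by
    rw [mul_comm, Nat.mul_add_div hd, Nat.div_eq_of_lt hi, add_zero]
  have hmod : (k * p.natDegree + i) % p.natDegree = i := by
    rw [mul_comm, Nat.mul_add_mod, Nat.mod_eq_of_lt hi]
  have : p ^ (e - 1 - k) * monomial i (r.coeff i)
      = r.coeff i • (p ^ (e - 1 - k) * X ^ i) := by
    rw [← C_mul_X_pow_eq_monomial, smul_eq_C_mul]
    ring
  rw [this, Submodule.mkQ_apply, Submodule.Quotient.mk_smul]
  refine Submodule.smul_mem _ _ (Submodule.subset_span ⟨⟨_, hlt⟩, hdiv, ?_⟩)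
  simp only [chainVector, hdiv, hmod]

/-- Multiplication by `X` raises `s` inside a block. At the end of a block, dividing `X ^ d` by `p`
leaves a remainder in the same block plus a multiple of the next higher power of `p`, the first
vector of the preceding block. -/
theorem X_smul_chainVector_mem {p : F[X]} (hp : 0 < p.natDegree) {e a : ℕ}
    (ha : a < e * p.natDegree) :
    (X : F[X]) • chainVector p e a ∈
      Submodule.span F ((fun b : Fin (e * p.natDegree) => chainVector p e b) ''
        {b | a / p.natDegree = b / p.natDegree ∨
          a / p.natDegree = b / p.natDegree + 1}) := by
  set d := p.natDegree with hd
  have hk : a / d < e := Nat.div_lt_of_lt_mul (by rwa [mul_comm])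
  have hs : a % d < d := Nat.mod_lt _ hp
  have hX : (X : F[X]) • chainVector p e a = Submodule.Quotient.mk
      (p ^ (e - 1 - a / d) * X ^ (a % d + 1)) := by
    rw [chainVector, ← Submodule.Quotient.mk_smul, smul_eq_mul]
    congr 1
    ring
  rw [hX]
  have hblock {r : F[X]} (hr : r.natDegree < d) : (Submodule.Quotient.mk
      (p ^ (e - 1 - a / d) * r) : F[X] ⧸ Submodule.span F[X] {p ^ e}) ∈
      Submodule.span F ((fun b : Fin (e * d) => chainVector p e b) ''
        {b | a / d = b / d ∨ a / d = b / d + 1}) :=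
    Submodule.span_mono (Set.image_mono fun b hb => Or.inl (Eq.symm hb))
      (mk_pow_mul_mem_span_chainVector hk hr)
  by_cases hlt : a % d + 1 < d
  · exact hblock (by rwa [natDegree_X_pow])
  have hsd : a % d + 1 = d := by omega
  have hp0 : p ≠ 0 := by
    rintro rfl
    simp [hd] at hp
  -- `p` need not be monic, so it is normalised before cancelling `X ^ d`.
  have hu : p.leadingCoeff⁻¹ ≠ 0 := inv_ne_zero (leadingCoeff_ne_zero.2 hp0)
  have hr : (X ^ d - C p.leadingCoeff⁻¹ * p).natDegree < d := by
    have hdeg : (X ^ d - C p.leadingCoeff⁻¹ * p).degree < (X ^ d : F[X]).degree := by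
      apply degree_sub_lt_left
      · rw [degree_C_mul hu, degree_X_pow, degree_eq_natDegree hp0]
      · exact pow_ne_zero _ X_ne_zero
      · rw [leadingCoeff_X_pow, leadingCoeff_mul, leadingCoeff_C,
          inv_mul_cancel₀ (leadingCoeff_ne_zero.2 hp0)]
    rw [degree_X_pow] at hdeg
    by_cases h0 : X ^ d - C p.leadingCoeff⁻¹ * p = 0
    · rwa [h0, natDegree_zero]
    · exact (natDegree_lt_iff_degree_lt h0).2 hdeg
  have hsplit : p ^ (e - 1 - a / d) * X ^ (a % d + 1)
      = p ^ (e - 1 - a / d) * (X ^ d - C p.leadingCoeff⁻¹ * p)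
        + p.leadingCoeff⁻¹ • p ^ (e - a / d) := by
    have : e - a / d = e - 1 - a / d + 1 := by omega
    rw [hsd, this, smul_eq_C_mul]
    ring
  rw [hsplit, Submodule.Quotient.mk_add, Submodule.Quotient.mk_smul]
  refine Submodule.add_mem _ (hblock hr) (Submodule.smul_mem _ _ ?_)
  -- In block 0 the carried term is `p ^ e`, zero in the quotient.
  rcases Nat.eq_zero_or_pos (a / d) with h0 | h0
  · rw [h0, Nat.sub_zero, (Submodule.Quotient.mk_eq_zero _).2 (Submodule.mem_span_singleton_self _)]
    exact Submodule.zero_mem _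
  · have h1 := mk_pow_mul_mem_span_chainVector (p := p) (e := e) (k := a / d - 1) (r := 1)
      (by omega) (by rwa [natDegree_one])
    have h2 : e - 1 - (a / d - 1) = e - a / d := by omega
    rw [mul_one, h2] at h1
    refine Submodule.span_mono (Set.image_mono fun b hb => Or.inr ?_) h1
    have hb' : (b : ℕ) / d = a / d - 1 := hb
    omega

/-- The span contains the class of 1 and is stable under `X`. -/
theorem span_chainVector_eq_top {p : F[X]} (hp : 0 < p.natDegree) (e : ℕ) :
    ⊤ ≤ Submodule.span F (Set.range fun b : Fin (e * p.natDegree) => chainVector p e b) := by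
  set S := Submodule.span F (Set.range fun b : Fin (e * p.natDegree) => chainVector p e b)
  have hX : ∀ x ∈ S, (X : F[X]) • x ∈ S := by
    intro x hx
    induction hx using Submodule.span_induction with
    | mem x hx =>
      obtain ⟨a, rfl⟩ := hx
      exact Submodule.span_mono (Set.image_subset_range _ _) (X_smul_chainVector_mem hp a.2)
    | zero => rw [smul_zero]; exact S.zero_mem
    | add x y _ _ hx hy => rw [smul_add]; exact S.add_mem hx hy
    | smul c x _ hx => rw [smul_comm]; exact S.smul_mem c hx
  have h1 : (Submodule.Quotient.mk 1 : F[X] ⧸ Submodule.span F[X] {p ^ e}) ∈ S := by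
    rcases Nat.eq_zero_or_pos e with rfl | he
    · rw [(Submodule.Quotient.mk_eq_zero _).2 (by
        rw [pow_zero]
        exact Submodule.mem_span_singleton_self _)]
      exact S.zero_mem
    · have := mk_pow_mul_mem_span_chainVector (p := p) (e := e) (k := e - 1) (r := 1) (by omega)
        (by rwa [natDegree_one])
      rw [Nat.sub_self, pow_zero, one_mul] at this
      exact Submodule.span_mono (Set.image_subset_range _ _) this
  rintro x -
  obtain ⟨q, rfl⟩ := Submodule.Quotient.mk_surjective _ x
  induction q using Polynomial.induction_on' with
  | add q r hq hr => rw [Submodule.Quotient.mk_add]; exact S.add_mem hq hr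
  | monomial n c =>
    rw [← C_mul_X_pow_eq_monomial, ← smul_eq_C_mul, Submodule.Quotient.mk_smul]
    refine S.smul_mem _ ?_
    induction n with
    | zero => rwa [pow_zero]
    | succ n ih =>
      rw [pow_succ', ← smul_eq_mul, Submodule.Quotient.mk_smul]
      exact hX _ ih

theorem exists_chain_basis {p : F[X]} (hp : 0 < p.natDegree) (e : ℕ) :
    ∃ c : Basis (Fin (e * p.natDegree)) F (F[X] ⧸ Submodule.span F[X] {p ^ e}),
      ∀ a : Fin (e * p.natDegree), (X : F[X]) • c a ∈ Submodule.span F (c ''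
        {b | (a : ℕ) / p.natDegree = b / p.natDegree ∨
          (a : ℕ) / p.natDegree = b / p.natDegree + 1}) := by
  refine ⟨basisOfTopLeSpanOfCardEqFinrank _ (span_chainVector_eq_top hp e) ?_, fun a => ?_⟩
  · rw [Fintype.card_fin, ← natDegree_pow]
    exact finrank_quotient_span_eq_natDegree.symm
  · rw [coe_basisOfTopLeSpanOfCardEqFinrank]
    exact X_smul_chainVector_mem hp a.2

end Chain

end TProduct

namespace TProduct

open Polynomial Module DirectSum

/-! ### Normal form over a field with irreducibles of degree at most 2 -/

section Field

universe u

variable {F : Type u} [Field F]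

/-- `V` with `X` acting as `T` is a finitely generated torsion `F[X]`-module; the chain bases of its
primary cyclic summands are put together. -/
theorem exists_chain_decomposition {V : Type*} [AddCommGroup V] [Module F V]
    [FiniteDimensional F V] (hF : ∀ q : F[X], Irreducible q → q.natDegree ≤ 2) (T : V →ₗ[F] V) :
    ∃ (ι : Type u) (_ : Fintype ι) (d e : ι → ℕ) (b : Basis (Σ i, Fin (e i * d i)) F V),
      (∀ i, d i = 1 ∨ d i = 2) ∧ ∀ s t, b.repr (T (b t)) s ≠ 0 →
        s.1 = t.1 ∧ ((t.2 : ℕ) / d t.1 = s.2 / d s.1 ∨ (t.2 : ℕ) / d t.1 = s.2 / d s.1 + 1) := by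
  classical
  have htors : Module.IsTorsion F[X] (AEval' T) :=
    AEval.isTorsion_of_finiteDimensional F V T
  obtain ⟨ι, _, p, hp, e, ⟨f⟩⟩ := Module.equiv_directSum_of_isTorsion htors
  have hpos : ∀ i, 0 < (p i).natDegree := fun i => (hp i).natDegree_pos
  choose c hc using fun i => exists_chain_basis (hpos i) (e i)
  let g : V ≃ₗ[F] ⨁ i, F[X] ⧸ Submodule.span F[X] {p i ^ e i} :=
    (AEval'.of T).trans (f.restrictScalars F)
  have hg : ∀ v, g (T v) = (X : F[X]) • g v := by
    intro v
    change f (AEval'.of T (T v)) = (X : F[X]) • f (AEval'.of T v)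
    rw [← AEval'.X_smul_of, map_smul]
  let b : Basis (Σ i, Fin (e i * (p i).natDegree)) F V := (DFinsupp.basis c).map g.symm
  let φ (i : ι) : (F[X] ⧸ Submodule.span F[X] {p i ^ e i}) →ₗ[F] V :=
    g.symm.toLinearMap ∘ₗ DirectSum.lof F ι (fun i => F[X] ⧸ Submodule.span F[X] {p i ^ e i}) i
  have hφ : ∀ i x, φ i ((X : F[X]) • x) = T (φ i x) := by
    intro i x
    apply g.injective
    rw [hg]
    simp only [φ, LinearMap.comp_apply, LinearEquiv.coe_coe, LinearEquiv.apply_symm_apply]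
    exact (DirectSum.lof F[X] ι (fun i => F[X] ⧸ Submodule.span F[X] {p i ^ e i}) i).map_smul X x
  have hb : ∀ i a, b ⟨i, a⟩ = φ i (c i a) := by
    intro i a
    simp only [b, φ, Basis.map_apply, LinearMap.comp_apply, LinearEquiv.coe_coe]
    congr 1
    simp [DFinsupp.basis]
    rfl
  refine ⟨ι, inferInstance, fun i => (p i).natDegree, e, b, fun i => ?_, ?_⟩
  · have := hF _ (hp i)
    have := hpos i
    dsimp only
    omega
  · rintro s ⟨i, a⟩ hs
    have hmem : T (b ⟨i, a⟩) ∈ Submodule.span F (b '' (Sigma.mk i ''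
        {b : Fin (e i * (p i).natDegree) | (a : ℕ) / (p i).natDegree = b / (p i).natDegree ∨
          (a : ℕ) / (p i).natDegree = b / (p i).natDegree + 1})) := by
      rw [hb, ← hφ, Set.image_image]
      simp_rw [hb]
      rw [← Set.image_image (φ i) (c i), Submodule.span_image]
      exact Submodule.mem_map_of_mem (hc i a)
    rw [Basis.mem_span_image] at hmem
    obtain ⟨b', hb', rfl⟩ := hmem (Finsupp.mem_support_iff.2 hs)
    exact ⟨rfl, hb'⟩

/-- The indices of a finite type can be enumerated so that those satisfying `q` come first. -/
theorem exists_equiv_fin_initial {ι : Type*} [Fintype ι] (q : ι → Prop) :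
    ∃ (N : ℕ) (ε : Fin N ≃ ι), ∀ i j, i ≤ j → q (ε j) → q (ε i) := by
  classical
  let ε := (Fintype.equivFin ι).symm
  let k : Fin (Fintype.card ι) → ℕ := fun i => if q (ε i) then 0 else 1
  refine ⟨_, (Tuple.sort k).trans ε, fun i j hij hj => ?_⟩
  have h := Tuple.monotone_sort k hij
  by_contra hi
  simp only [Equiv.trans_apply] at hi hj
  simp [k, hi, hj] at h

theorem exists_basis_isPairBiDiagonal {V : Type*} [AddCommGroup V] [Module F V]
    [FiniteDimensional F V] (hF : ∀ q : F[X], Irreducible q → q.natDegree ≤ 2) (T : V →ₗ[F] V)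
    {n : ℕ} (hn : finrank F V = n) :
    ∃ b : Basis (Fin n) F V, IsPairBiDiagonal (LinearMap.toMatrix b b T) := by
  obtain ⟨ι, _, d, e, b, hd, hb⟩ := exists_chain_decomposition hF T
  -- Quadratic chains come first, so each starts at an even offset.
  obtain ⟨N, ε, hε⟩ := exists_equiv_fin_initial fun i => d i = 2
  let σ : (Σ i, Fin (e i * d i)) ≃ Fin (∑ i, e (ε i) * d (ε i)) :=
    (Equiv.sigmaCongrLeft (β := fun i => Fin (e i * d i)) ε).symm.trans finSigmaFinEquiv
  obtain rfl : ∑ i, e (ε i) * d (ε i) = n := by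
    rw [← hn, finrank_eq_card_basis (b.reindex σ), Fintype.card_fin]
  refine ⟨b.reindex σ, fun x y hxy => ?_⟩
  rw [LinearMap.toMatrix_apply, Basis.repr_reindex_apply, Basis.reindex_apply] at hxy
  obtain ⟨⟨i, a⟩, rfl⟩ : ∃ s : Σ i, Fin (e (ε i) * d (ε i)), finSigmaFinEquiv s = x :=
    finSigmaFinEquiv.surjective x
  obtain ⟨⟨j, a'⟩, rfl⟩ : ∃ s : Σ i, Fin (e (ε i) * d (ε i)), finSigmaFinEquiv s = y :=
    finSigmaFinEquiv.surjective y
  have hσ : ∀ s : Σ i, Fin (e (ε i) * d (ε i)), σ.symm (finSigmaFinEquiv s) = ⟨ε s.1, s.2⟩ := by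
    intro s
    simp [σ, Equiv.sigmaCongrLeft]
  rw [hσ, hσ] at hxy
  obtain ⟨h1, h2⟩ := hb _ _ hxy
  obtain rfl : i = j := ε.injective h1
  rw [finSigmaFinEquiv_apply, finSigmaFinEquiv_apply]
  simp only at h2 ⊢
  generalize (a : ℕ) = x at h2 ⊢
  generalize (a' : ℕ) = y at h2 ⊢
  rcases hd (ε i) with h | h
  · rw [h, Nat.div_one, Nat.div_one] at h2
    omega
  · obtain ⟨m, hm⟩ : 2 ∣ ∑ k : Fin (i : ℕ), e (ε (Fin.castLE i.2.le k)) *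
        d (ε (Fin.castLE i.2.le k)) := by
      refine Finset.dvd_sum fun k _ => Dvd.dvd.mul_left ?_ _
      rw [hε (Fin.castLE i.2.le k) i (Fin.le_def.2 k.2.le) h]
    rw [h] at h2
    omega

theorem hasPairForms_of_irreducible_natDegree_le_two
    (hF : ∀ q : F[X], Irreducible q → q.natDegree ≤ 2) : HasPairForms F := by
  intro n A
  obtain ⟨b, hb⟩ : ∃ b : Basis (Fin n) F (Fin n → F),
      IsPairBiDiagonal (LinearMap.toMatrix b b (Matrix.toLin' A)) :=
    exists_basis_isPairBiDiagonal hF (Matrix.toLin' A) (finrank_fin_fun F)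
  refine ⟨(Pi.basisFun F (Fin n)).toMatrix b, b.toMatrix (Pi.basisFun F (Fin n)), _,
    Basis.toMatrix_mul_toMatrix_flip _ _, Basis.toMatrix_mul_toMatrix_flip _ _, hb, ?_⟩
  rw [basis_toMatrix_mul_linearMap_toMatrix_mul_basis_toMatrix, LinearMap.toMatrix_eq_toMatrix',
    LinearMap.toMatrix'_toLin']

end Field

theorem hasPairForms_real : HasPairForms ℝ :=
  hasPairForms_of_irreducible_natDegree_le_two fun _ hq => hq.natDegree_le_two

theorem hasPairForms_complex : HasPairForms ℂ :=
  hasPairForms_of_irreducible_natDegree_le_two fun q hq => by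
    rw [natDegree_eq_of_degree_eq_some (IsAlgClosed.degree_eq_one_of_irreducible ℂ hq)]
    norm_num

end TProduct

theorem mainTheorem3 (n p : ℕ) [NeZero p] (A : TProduct.Tensor ℝ n n p) :
    ∃ P J : TProduct.Tensor ℝ n n p,
      TProduct.IsTInvertible P ∧
      TProduct.IsFUpperBlockBiDiagonal J ∧
      (∃ Pinv : TProduct.Tensor ℝ n n p, TProduct.IsTInverse P Pinv ∧
        A = TProduct.tProd (TProduct.tProd P J) Pinv) ∧
      (∀ k : Fin p, ∃ c : Composition n,
        (∀ b ∈ c.blocks, b ≤ 2) ∧ TProduct.IsBlockBiDiagonalFor c (J k)) := by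
  obtain ⟨P, Pinv, J, hP, hA, hJ⟩ := TProduct.exists_tJordan TProduct.hasPairForms_real
    TProduct.hasPairForms_complex n p A
  refine ⟨P, J, ⟨Pinv, hP⟩, fun k => ⟨TProduct.pairComposition n,
    fun b hb => TProduct.pairComposition_blocks hb, (hJ k).isBlockBiDiagonalFor⟩,
    ⟨Pinv, hP, hA⟩, fun k => ⟨TProduct.pairComposition n, fun b hb => ?_,
      (hJ k).isBlockBiDiagonalFor⟩⟩
  have := TProduct.pairComposition_blocks hb
  omega
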